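/- Let $E=\{m+ni : m\in\mathbb{N},\ m\ge 1,\ n\in\mathbb{Z}\}\subset\mathbb{C}$ be the set of Gaussian integers with positive real part, let $X=\overline{B}(1/2,1/2)\subset\mathbb{C}$, and for $e\in E$ let $\phi_e:X\to X$, $\phi_e(z)=\frac{1}{e+z}$. For $I\subset E$ the limit set $J_I$ of the complex continued fractions system $\{\phi_e\}_{e\in I}$ is $$J_I=\bigcup_{\omega\in I^{\mathbb{N}}}\ \bigcap_{n\ge 1}\phi_{\omega_1}\circ\cdots\circ\phi_{\omega_n}(X)$$ (each of these intersections is a single point). Write $B(z,r)$ for the open Euclidean ball in $\mathbb{C}$. For $A\subset\mathbb{C}$, $x\in\mathbb{C}$ and $r>0$ put $$\operatorname{por}(A,x,r)=\sup\{c\ge 0: B(y,cr)\subset B(x,r)\setminus A \text{ for some } y\in\mathbb{C}\},$$ and call a bounded set $A$ porous if there are $c\in(0,1)$ and $r_0>0$ such that $\operatorname{por}(A,x,r)\ge c$ for all $x\in A$ and all $r\in(0,r_0)$. **Theorem.** Let $I$ be an infinite subset of $E$. 1. $\overline{J_I}$ is porous if and only if there exist $\theta\in(0,1)$, $\kappa\in(0,1)$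 and $\rho>0$ such that for every $i\in I$ and every $R\in[\rho,\kappa|i|]$ there exists $y\in B(i,R)$ with $$E\cap B(y,\theta R)\subset E\setminus I.$$ 2. $\overline{J_I}$ is porous if and only if there exist $\theta\in(0,1)$ and $\kappa\in(0,1)$ such that for every $i\in I$ and every $R\in(0,\kappa|i|]$ there exists $y\in B(i,R)$ with $$E\cap B(y,\theta R)\subset E\setminus I.$$ -/

import Mathlib

open scoped NNReal ENNReal

noncomputable section

/-- The porosity `por(A, x, r) = sup {c ≥ 0 : B(y, c r) ⊆ B(x, r) \ A for some y}` of a set `A`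
at the point `x` and scale `r`, with open balls and with values in `[0, ∞]`. -/
def por {X : Type*} [MetricSpace X] (A : Set X) (x : X) (r : ℝ) : ℝ≥0∞ :=
  ⨆ (c : ℝ≥0) (_ : ∃ y : X, Metric.ball y (c * r) ⊆ Metric.ball x r \ A), (c : ℝ≥0∞)

/-- A set `A` is porous if, for some `c ∈ (0, 1)` and some `r₀ > 0`, one has `por(A, x, r) ≥ c`
for all `x ∈ A` and all `r ∈ (0, r₀)`. -/
def IsPorous {X : Type*} [MetricSpace X] (A : Set X) : Prop :=
  ∃ c ∈ Set.Ioo (0 : ℝ) 1, ∃ r₀ > (0 : ℝ), ∀ x ∈ A, ∀ r ∈ Set.Ioo (0 : ℝ) r₀,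
    ENNReal.ofReal c ≤ por A x r

/-- The Gaussian integers with positive real part, `{m + n i : m ≥ 1, n ∈ ℤ}`. -/
def gaussianE : Set ℂ :=
  {z | ∃ m : ℕ, ∃ n : ℤ, 1 ≤ m ∧ z = (m : ℂ) + (n : ℂ) * Complex.I}

/-- The closed disc `X` of centre `1/2` and radius `1/2`. -/
def ccfDisc : Set ℂ := Metric.closedBall (1 / 2 : ℂ) (1 / 2)

/-- The generator `φ_e(z) = 1 / (e + z)`; for `e ∈ gaussianE` it maps `ccfDisc` into itself, and
the denominator has real part at least `1` there. -/
def ccfMap (e z : ℂ) : ℂ := 1 / (e + z)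

/-- `ccfWord ω n = φ_{ω 0} ∘ φ_{ω 1} ∘ ⋯ ∘ φ_{ω (n - 1)}`, the map coded by the first `n` letters
of the infinite word `ω`. -/
def ccfWord (ω : ℕ → ℂ) : ℕ → ℂ → ℂ
  | 0 => id
  | n + 1 => ccfWord ω n ∘ ccfMap (ω n)

/-- The limit set `J_I`: the set of all points coded by infinite words `ω` over the alphabet `I`,
where the point coded by `ω` is the one element of `⋂ n, φ_{ω|n}(X)`. -/
def ccfLimitSet (I : Set ℂ) : Set ℂ :=
  {z | ∃ ω : ℕ → ℂ, (∀ n, ω n ∈ I) ∧ z ∈ ⋂ n : ℕ, ccfWord ω n '' ccfDisc}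

end

/-!
Write `X` for `ccfDisc`, `J` for `ccfLimitSet I` and `g` for the word maps `ccfWord ω n`. A hole of a
set is a disc that misses it. Inversion takes discs about points `i + z` with `z ∈ X` and `i ∈ I` to
discs about points of `φ_i(X)`, with scale factor comparable to `1 / |i| ^ 2` as long as the radius
is small compared with `|i|`; this relates gaps of the alphabet near `i` to holes of `J`.

From porosity to gaps (`exists_gap_of_isPorous`): fix `z₀ ∈ J`. A hole of `J` near `1 / (i + z₀)`
is inverted to a disc which contains no point `e + z₀` with `e ∈ I`, because `1 / (e + z₀) ∈ J`. At
scales above a constant the bounded offset `z₀` is harmless, so a slightly smaller disc contains no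
letter at all. Small scales cost nothing, since Gaussian integers are separated
(`exists_gap_all_scales`), so that the two gap conditions are equivalent.

From gaps to porosity (`isPorous_of_gaps`): the gap condition near letters self-improves to a gap
of proportional size, inside the open right half plane, in every disc centred in the closed right
half plane (`exists_gap_in_halfPlane`). Inverting such gaps gives holes of `J` inside the interior
of `X` (`exists_hole_near_inv`, `exists_hole_at_scale`). Being in the interior matters: by the open
set condition (`mem_ccfLimitSet_of_ccfWord_mem`) the part of `J` in `g (int X)` is contained in
`g J`, so `g` carries holes in `int X` to sets free of `J`, and by bounded distortion these contain
discs of comparable size (`exists_hole_ccfWord`).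

The distortion estimate rests on the identity `ccfWord_sub`,
`g v - g u = σ (v - u) / ((1 + t v) (1 + t u))`, in which `t`, a ratio of successive continuants,
stays in `X`; there `3 / 4 ≤ |1 + t z| ≤ 2`. Given `x ∈ J` and a radius `r`, the level is chosen so
that `|σ|` passes `r / 2` in the next step. If it drops only by a bounded factor, a fixed hole of
`J` in `X` is transported by the next word map. Otherwise the next letter is so large that the
pulled back radius lies in the range where gaps of the alphabet yield holes.
-/

open Metric Set

/-! ### Porosity and holes -/

lemma exists_hole_of_isPorous {X : Type*} [MetricSpace X] {A : Set X} (h : IsPorous A) :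
    ∃ c ∈ Ioo (0 : ℝ) 1, ∃ r₀ > (0 : ℝ), ∀ x ∈ A, ∀ r ∈ Ioo (0 : ℝ) r₀,
      ∃ y, ball y (c * r) ⊆ ball x r \ A := by
  obtain ⟨c, ⟨hc0, hc1⟩, r₀, hr₀, h⟩ := h
  refine ⟨c / 2, ⟨by linarith, by linarith⟩, r₀, hr₀, fun x hx r hr => ?_⟩
  have h1 : ENNReal.ofReal (c / 2) < por A x r :=
    lt_of_lt_of_le ((ENNReal.ofReal_lt_ofReal_iff hc0).2 (by linarith)) (h x hx r hr)
  obtain ⟨b, hb⟩ := lt_iSup_iff.1 h1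
  obtain ⟨⟨y, hy⟩, hb⟩ := lt_iSup_iff.1 hb
  refine ⟨y, (ball_subset_ball ?_).trans hy⟩
  have h2 : c / 2 ≤ b := by
    rw [ENNReal.ofReal, ENNReal.coe_lt_coe] at hb
    exact (Real.le_coe_toNNReal _).trans (by exact_mod_cast hb.le)
  exact mul_le_mul_of_nonneg_right h2 hr.1.le

/-- Holes at points of `A` suffice for the porosity of the closure: an open hole of `A` misses
`closure A`, and a point of `closure A` may be replaced by a nearby point of `A`. -/
lemma isPorous_closure_of_exists_hole {X : Type*} [MetricSpace X] {A : Set X} {c r₀ : ℝ}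
    (hc : 0 < c) (hr₀ : 0 < r₀)
    (h : ∀ x ∈ A, ∀ r ∈ Ioo (0 : ℝ) r₀, ∃ y, ball y (c * r) ⊆ ball x r \ A) :
    IsPorous (closure A) := by
  have hc' : 0 < min (c / 2) (1 / 2) := lt_min (by linarith) (by norm_num)
  refine ⟨min (c / 2) (1 / 2), ⟨hc', by linarith [min_le_right (c / 2) (1 / 2 : ℝ)]⟩, r₀, hr₀,
    fun x hx r hr => ?_⟩
  obtain ⟨x', hx', hd⟩ := Metric.mem_closure_iff.1 hx (r / 2) (by linarith [hr.1])
  obtain ⟨y, hy⟩ := h x' hx' (r / 2) ⟨by linarith [hr.1], by linarith [hr.1, hr.2]⟩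
  refine le_iSup₂_of_le (min (c / 2) (1 / 2)).toNNReal ⟨y, ?_⟩ le_rfl
  rw [Real.coe_toNNReal _ hc'.le]
  have hsub : ball y (min (c / 2) (1 / 2) * r) ⊆ ball y (c * (r / 2)) :=
    ball_subset_ball (by nlinarith [min_le_left (c / 2) (1 / 2 : ℝ), hr.1])
  intro p hp
  refine ⟨?_, fun hpc => ?_⟩
  · have h1 := (hy (hsub hp)).1
    rw [mem_ball] at h1 ⊢
    linarith [dist_triangle p x' x, dist_comm x x']
  · obtain ⟨q, hq, hqA⟩ := mem_closure_iff.1 hpc _ isOpen_ball (hsub hp)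
    exact (hy hq).2 hqA

/-! ### The disc and the generators -/

lemma mem_ccfDisc {z : ℂ} : z ∈ ccfDisc ↔ Complex.normSq z ≤ z.re := by
  rw [ccfDisc, mem_closedBall, Complex.dist_eq,
    ← sq_le_sq₀ (norm_nonneg _) (by norm_num : (0 : ℝ) ≤ 1 / 2), ← Complex.normSq_eq_norm_sq,
    Complex.normSq_apply, Complex.normSq_apply]
  have h1 : (z - 1 / 2).re = z.re - 1 / 2 := by simp
  have h2 : (z - 1 / 2).im = z.im := by simp
  rw [h1, h2]
  constructor <;> intro h <;> nlinarith

lemma mem_openDisc {z : ℂ} : z ∈ ball (1 / 2 : ℂ) (1 / 2) ↔ Complex.normSq z < z.re := by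
  rw [mem_ball, Complex.dist_eq,
    ← sq_lt_sq₀ (norm_nonneg _) (by norm_num : (0 : ℝ) ≤ 1 / 2), ← Complex.normSq_eq_norm_sq,
    Complex.normSq_apply, Complex.normSq_apply]
  have h1 : (z - 1 / 2).re = z.re - 1 / 2 := by simp
  have h2 : (z - 1 / 2).im = z.im := by simp
  rw [h1, h2]
  constructor <;> intro h <;> nlinarith

lemma openDisc_subset_ccfDisc : ball (1 / 2 : ℂ) (1 / 2) ⊆ ccfDisc := ball_subset_closedBall

lemma inv_mem_ccfDisc {w : ℂ} (hw : 1 ≤ w.re) : 1 / w ∈ ccfDisc := by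
  have h0 : 0 < Complex.normSq w := by rw [Complex.normSq_apply]; nlinarith [mul_self_nonneg w.im]
  rw [mem_ccfDisc, one_div, Complex.normSq_inv, Complex.inv_re, inv_eq_one_div]
  gcongr

lemma inv_mem_openDisc {w : ℂ} (hw : 1 < w.re) : 1 / w ∈ ball (1 / 2 : ℂ) (1 / 2) := by
  have h0 : 0 < Complex.normSq w := by rw [Complex.normSq_apply]; nlinarith [mul_self_nonneg w.im]
  rw [mem_openDisc, one_div, Complex.normSq_inv, Complex.inv_re, inv_eq_one_div]
  gcongr

lemma re_nonneg_of_mem_ccfDisc {z : ℂ} (hz : z ∈ ccfDisc) : 0 ≤ z.re :=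
  (Complex.normSq_nonneg z).trans (mem_ccfDisc.1 hz)

lemma norm_le_one_of_mem_ccfDisc {z : ℂ} (hz : z ∈ ccfDisc) : ‖z‖ ≤ 1 := by
  have h := mem_ccfDisc.1 hz
  rw [Complex.normSq_eq_norm_sq] at h
  nlinarith [norm_nonneg z, Complex.re_le_norm z]

lemma one_le_re_of_mem_gaussianE {e : ℂ} (he : e ∈ gaussianE) : 1 ≤ e.re := by
  obtain ⟨m, n, hm, rfl⟩ := he
  simpa using hm

lemma one_le_re_add {e z : ℂ} (he : e ∈ gaussianE) (hz : z ∈ ccfDisc) : 1 ≤ (e + z).re := by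
  rw [Complex.add_re]
  linarith [one_le_re_of_mem_gaussianE he, re_nonneg_of_mem_ccfDisc hz]

lemma ne_zero_of_one_le_re {w : ℂ} (hw : 1 ≤ w.re) : w ≠ 0 := by
  rintro rfl
  norm_num at hw

lemma one_le_norm_of_one_le_re {w : ℂ} (hw : 1 ≤ w.re) : 1 ≤ ‖w‖ :=
  hw.trans (Complex.re_le_norm w)

lemma ccfMap_mem_ccfDisc {e z : ℂ} (he : e ∈ gaussianE) (hz : z ∈ ccfDisc) :
    ccfMap e z ∈ ccfDisc :=
  inv_mem_ccfDisc (one_le_re_add he hz)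

lemma ccfMap_mem_openDisc {e z : ℂ} (he : e ∈ gaussianE)
    (hz : z ∈ ball (1 / 2 : ℂ) (1 / 2)) : ccfMap e z ∈ ball (1 / 2 : ℂ) (1 / 2) := by
  refine inv_mem_openDisc ?_
  rw [Complex.add_re]
  linarith [one_le_re_of_mem_gaussianE he, mem_openDisc.1 hz, Complex.normSq_nonneg z]

lemma one_le_dist_of_mem_gaussianE {e e' : ℂ} (he : e ∈ gaussianE) (he' : e' ∈ gaussianE)
    (hne : e ≠ e') : 1 ≤ ‖e - e'‖ := by
  obtain ⟨m, n, -, rfl⟩ := he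
  obtain ⟨m', n', -, rfl⟩ := he'
  have h : ((m : ℂ) + n * Complex.I) - (m' + n' * Complex.I)
      = (⟨(m - m' : ℤ), (n - n' : ℤ)⟩ : GaussianInt) := by
    rw [GaussianInt.toComplex_def₂]
    apply Complex.ext <;> simp
  rw [h, ← sq_le_sq₀ zero_le_one (norm_nonneg _), ← Complex.normSq_eq_norm_sq,
    ← GaussianInt.intCast_real_norm, one_pow]
  have h0 : (⟨(m - m' : ℤ), (n - n' : ℤ)⟩ : GaussianInt) ≠ 0 := by
    intro h0
    rw [h0, map_zero, sub_eq_zero] at h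
    exact hne h
  exact_mod_cast Int.add_one_le_of_lt (GaussianInt.norm_pos.2 h0)

/-- The open set condition at the level of the generators: the open disc `e + int X` meets no
other disc `e' + X`. -/
lemma eq_of_add_eq_add {e e' z z' : ℂ} (he : e ∈ gaussianE) (he' : e' ∈ gaussianE)
    (hz : z ∈ ball (1 / 2 : ℂ) (1 / 2)) (hz' : z' ∈ ccfDisc) (h : e + z = e' + z') : e = e' := by
  by_contra hne
  have h1 := one_le_dist_of_mem_gaussianE he he' hne
  rw [mem_ball, Complex.dist_eq] at hz
  rw [ccfDisc, mem_closedBall, Complex.dist_eq] at hz'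
  have h2 : e - e' = (z' - 1 / 2) - (z - 1 / 2) := by linear_combination h
  rw [h2] at h1
  linarith [norm_sub_le (z' - 1 / 2) (z - 1 / 2)]

/-- Both factors have imaginary part at most `1 / 2` in absolute value and non-negative real part,
so that the product has real part at least `-1 / 4`. -/
lemma three_quarters_le_norm_one_add_mul {t z : ℂ} (ht : t ∈ ccfDisc) (hz : z ∈ ccfDisc) :
    3 / 4 ≤ ‖1 + t * z‖ := by
  refine le_trans ?_ (Complex.re_le_norm _)
  have h1 := mem_ccfDisc.1 ht
  have h2 := mem_ccfDisc.1 hz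
  rw [Complex.normSq_apply] at h1 h2
  have h3 : t.im ^ 2 ≤ 1 / 4 := by nlinarith [sq_nonneg (t.re - 1 / 2)]
  have h4 : z.im ^ 2 ≤ 1 / 4 := by nlinarith [sq_nonneg (z.re - 1 / 2)]
  have h5 := mul_nonneg (re_nonneg_of_mem_ccfDisc ht) (re_nonneg_of_mem_ccfDisc hz)
  simp only [Complex.add_re, Complex.one_re, Complex.mul_re]
  nlinarith [sq_nonneg (t.im - z.im)]

lemma norm_one_add_mul_le_two {t z : ℂ} (ht : t ∈ ccfDisc) (hz : z ∈ ccfDisc) :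
    ‖1 + t * z‖ ≤ 2 := by
  have h : ‖t * z‖ ≤ 1 := by
    rw [norm_mul]
    exact mul_le_one₀ (norm_le_one_of_mem_ccfDisc ht) (norm_nonneg _)
      (norm_le_one_of_mem_ccfDisc hz)
  calc ‖1 + t * z‖ ≤ ‖(1 : ℂ)‖ + ‖t * z‖ := norm_add_le _ _
    _ ≤ 2 := by rw [norm_one]; linarith

/-! ### Words and coded points -/

/-- `IsCoded ω z` says that `z` is the point coded by the infinite word `ω`. -/
def IsCoded (ω : ℕ → ℂ) (z : ℂ) : Prop := ∀ n, z ∈ ccfWord ω n '' ccfDisc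

lemma mem_ccfLimitSet {I : Set ℂ} {z : ℂ} :
    z ∈ ccfLimitSet I ↔ ∃ ω : ℕ → ℂ, (∀ n, ω n ∈ I) ∧ IsCoded ω z := by
  simp only [ccfLimitSet, mem_ofPred_eq, mem_iInter, IsCoded]

lemma ccfWord_succ' (ω : ℕ → ℂ) (n : ℕ) :
    ccfWord ω (n + 1) = ccfMap (ω 0) ∘ ccfWord (fun k => ω (k + 1)) n := by
  induction n with
  | zero => rfl
  | succ n ih =>
    rw [ccfWord, ih, Function.comp_assoc]
    rfl

lemma ccfWord_mem {s : Set ℂ} {ω : ℕ → ℂ} (h : ∀ n, ∀ z ∈ s, ccfMap (ω n) z ∈ s) (n : ℕ) :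
    ∀ z ∈ s, ccfWord ω n z ∈ s := by
  induction n with
  | zero => exact fun z hz => hz
  | succ n ih => exact fun z hz => ih _ (h n z hz)

lemma IsCoded.mem_ccfDisc {ω : ℕ → ℂ} {z : ℂ} (h : IsCoded ω z) : z ∈ ccfDisc := by
  simpa [ccfWord] using h 0

lemma ccfLimitSet_subset_ccfDisc (I : Set ℂ) : ccfLimitSet I ⊆ ccfDisc := by
  intro z hz
  obtain ⟨ω, -, h⟩ := mem_ccfLimitSet.1 hz
  exact h.mem_ccfDisc

lemma IsCoded.exists_eq_ccfMap {ω : ℕ → ℂ} {z : ℂ} (h : IsCoded ω z) :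
    ∃ z', IsCoded (fun k => ω (k + 1)) z' ∧ z = ccfMap (ω 0) z' := by
  have key : ∀ n, ∃ u ∈ ccfDisc, z = ccfMap (ω 0) (ccfWord (fun k => ω (k + 1)) n u) := by
    intro n
    obtain ⟨u, hu, huz⟩ := h (n + 1)
    exact ⟨u, hu, by rw [← huz, ccfWord_succ']; rfl⟩
  obtain ⟨u₀, hu₀, h₀⟩ := key 0
  refine ⟨u₀, fun n => ?_, h₀⟩
  obtain ⟨u, hu, hn⟩ := key n
  refine ⟨u, hu, ?_⟩
  have h1 : ω 0 + ccfWord (fun k => ω (k + 1)) n u = ω 0 + u₀ := by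
    apply inv_injective
    rw [inv_eq_one_div, inv_eq_one_div]
    exact hn.symm.trans h₀
  exact add_left_cancel h1

lemma IsCoded.exists_eq_ccfWord {ω : ℕ → ℂ} {z : ℂ} (h : IsCoded ω z) (n : ℕ) :
    ∃ z', IsCoded (fun k => ω (k + n)) z' ∧ z = ccfWord ω n z' := by
  induction n with
  | zero => exact ⟨z, h, rfl⟩
  | succ n ih =>
    obtain ⟨u, hu, rfl⟩ := ih
    obtain ⟨v, hv, rfl⟩ := hu.exists_eq_ccfMap
    refine ⟨v, ?_, ?_⟩
    · convert hv using 2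
      ring_nf
    · simp [ccfWord]

lemma exists_eq_ccfMap_of_mem_ccfLimitSet {I : Set ℂ} {z : ℂ} (hz : z ∈ ccfLimitSet I) :
    ∃ e ∈ I, ∃ z' ∈ ccfLimitSet I, z = ccfMap e z' := by
  obtain ⟨ω, hω, h⟩ := mem_ccfLimitSet.1 hz
  obtain ⟨z', h', he⟩ := h.exists_eq_ccfMap
  exact ⟨ω 0, hω 0, z', mem_ccfLimitSet.2 ⟨_, fun n => hω (n + 1), h'⟩, he⟩

lemma ccfMap_mem_ccfLimitSet {I : Set ℂ} (hIE : I ⊆ gaussianE) {e z : ℂ} (he : e ∈ I)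
    (hz : z ∈ ccfLimitSet I) : ccfMap e z ∈ ccfLimitSet I := by
  obtain ⟨ω, hω, h⟩ := mem_ccfLimitSet.1 hz
  refine mem_ccfLimitSet.2 ⟨fun n => Nat.casesOn n e ω, fun n => ?_, fun n => ?_⟩
  · cases n with
    | zero => exact he
    | succ n => exact hω n
  · cases n with
    | zero => exact ⟨_, ccfMap_mem_ccfDisc (hIE he) h.mem_ccfDisc, rfl⟩
    | succ n =>
      obtain ⟨u, hu, rfl⟩ := h n
      exact ⟨u, hu, by rw [ccfWord_succ']; rfl⟩

/-- The open set condition for words: a point of `J_I` in the image of the open disc under the word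
map of `ω` comes from a point of `J_I`. -/
lemma mem_ccfLimitSet_of_ccfWord_mem {I : Set ℂ} (hIE : I ⊆ gaussianE) (n : ℕ) :
    ∀ ω : ℕ → ℂ, (∀ k, ω k ∈ I) → ∀ p ∈ ball (1 / 2 : ℂ) (1 / 2),
      ccfWord ω n p ∈ ccfLimitSet I → p ∈ ccfLimitSet I := by
  induction n with
  | zero => exact fun ω _ p _ h => h
  | succ n ih =>
    intro ω hω p hp h
    rw [ccfWord_succ', Function.comp_apply] at h
    obtain ⟨e, he, z', hz', heq⟩ := exists_eq_ccfMap_of_mem_ccfLimitSet h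
    have hq : ccfWord (fun k => ω (k + 1)) n p ∈ ball (1 / 2 : ℂ) (1 / 2) :=
      ccfWord_mem (fun k z hz => ccfMap_mem_openDisc (hIE (hω (k + 1))) hz) n p hp
    have h1 : ω 0 + ccfWord (fun k => ω (k + 1)) n p = e + z' := by
      apply inv_injective
      rw [inv_eq_one_div, inv_eq_one_div]
      exact heq
    have h2 := eq_of_add_eq_add (hIE (hω 0)) (hIE he) hq
      (ccfLimitSet_subset_ccfDisc I hz') h1
    rw [h2, add_right_inj] at h1
    exact ih _ (fun k => hω (k + 1)) p hp (h1 ▸ hz')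

lemma continuousOn_ccfWord {ω : ℕ → ℂ} (hω : ∀ n, ω n ∈ gaussianE) (n : ℕ) :
    ContinuousOn (ccfWord ω n) ccfDisc := by
  induction n with
  | zero => exact continuousOn_id
  | succ n ih =>
    refine ih.comp ?_ fun z hz => ccfMap_mem_ccfDisc (hω n) hz
    exact continuousOn_const.div (continuousOn_const.add continuousOn_id)
      fun z hz => ne_zero_of_one_le_re (one_le_re_add (hω n) hz)

lemma exists_isCoded {ω : ℕ → ℂ} (hω : ∀ n, ω n ∈ gaussianE) : ∃ z, IsCoded ω z := by
  have hcomp : ∀ n, IsCompact (ccfWord ω n '' ccfDisc) := fun n =>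
    (isCompact_closedBall _ _).image_of_continuousOn (continuousOn_ccfWord hω n)
  have hne : ccfDisc.Nonempty := ⟨1 / 2, mem_closedBall_self (by norm_num)⟩
  obtain ⟨z, hz⟩ := IsCompact.nonempty_iInter_of_sequence_nonempty_isCompact_isClosed
    (fun n => ccfWord ω n '' ccfDisc)
    (fun n => by
      rintro _ ⟨u, hu, rfl⟩
      exact ⟨ccfMap (ω n) u, ccfMap_mem_ccfDisc (hω n) hu, rfl⟩)
    (fun n => hne.image _) (hcomp 0) (fun n => (hcomp n).isClosed)
  exact ⟨z, mem_iInter.1 hz⟩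

lemma ccfLimitSet_nonempty {I : Set ℂ} (hIE : I ⊆ gaussianE) (hI : I.Nonempty) :
    (ccfLimitSet I).Nonempty := by
  obtain ⟨e, he⟩ := hI
  obtain ⟨z, hz⟩ := exists_isCoded (ω := fun _ => e) fun _ => hIE he
  exact ⟨z, mem_ccfLimitSet.2 ⟨_, fun _ => he, hz⟩⟩

/-! ### Bounded distortion -/

/-- The ratio `q_{n-1} / q_n` of successive continuants of the word `ω`. -/
noncomputable def contRatio (ω : ℕ → ℂ) : ℕ → ℂ
  | 0 => 0
  | n + 1 => ccfMap (ω n) (contRatio ω n)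

/-- The derivative at `0` of the word map `ccfWord ω n`, that is `(-1) ^ n / q_n ^ 2` in terms of
the continuant `q_n`. -/
noncomputable def wordScale (ω : ℕ → ℂ) : ℕ → ℂ
  | 0 => 1
  | n + 1 => -wordScale ω n / (ω n + contRatio ω n) ^ 2

lemma contRatio_mem_ccfDisc {ω : ℕ → ℂ} (hω : ∀ n, ω n ∈ gaussianE) (n : ℕ) :
    contRatio ω n ∈ ccfDisc := by
  induction n with
  | zero => simp [contRatio, mem_ccfDisc]
  | succ n ih => exact ccfMap_mem_ccfDisc (hω n) ih

lemma wordScale_ne_zero {ω : ℕ → ℂ} (hω : ∀ n, ω n ∈ gaussianE) (n : ℕ) :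
    wordScale ω n ≠ 0 := by
  induction n with
  | zero => simp [wordScale]
  | succ n ih =>
    exact div_ne_zero (neg_ne_zero.2 ih) (pow_ne_zero 2 (ne_zero_of_one_le_re
      (one_le_re_add (hω n) (contRatio_mem_ccfDisc hω n))))

lemma norm_wordScale_succ (ω : ℕ → ℂ) (n : ℕ) :
    ‖wordScale ω (n + 1)‖ = ‖wordScale ω n‖ / ‖ω n + contRatio ω n‖ ^ 2 := by
  rw [wordScale, norm_div, norm_neg, norm_pow]

lemma one_add_mul_ne_zero {t z : ℂ} (ht : t ∈ ccfDisc) (hz : z ∈ ccfDisc) : 1 + t * z ≠ 0 := by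
  rw [← norm_pos_iff]
  linarith [three_quarters_le_norm_one_add_mul ht hz]

/-- A word map is a Möbius map with denominator `q_n * (1 + contRatio ω n * z)`; this is the
difference formula for such a map. -/
lemma ccfWord_sub {ω : ℕ → ℂ} (hω : ∀ n, ω n ∈ gaussianE) (n : ℕ) :
    ∀ u ∈ ccfDisc, ∀ v ∈ ccfDisc, ccfWord ω n v - ccfWord ω n u =
      wordScale ω n * (v - u) / ((1 + contRatio ω n * v) * (1 + contRatio ω n * u)) := by
  induction n with
  | zero => intro u _ v _; simp [ccfWord, wordScale, contRatio]
  | succ n ih =>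
    intro u hu v hv
    have ht := contRatio_mem_ccfDisc hω n
    have ht' := contRatio_mem_ccfDisc hω (n + 1)
    have h1 := ne_zero_of_one_le_re (one_le_re_add (hω n) ht)
    have h2 := ne_zero_of_one_le_re (one_le_re_add (hω n) hu)
    have h3 := ne_zero_of_one_le_re (one_le_re_add (hω n) hv)
    have h4 := one_add_mul_ne_zero ht (ccfMap_mem_ccfDisc (hω n) hu)
    have h5 := one_add_mul_ne_zero ht (ccfMap_mem_ccfDisc (hω n) hv)
    have h6 := one_add_mul_ne_zero ht' hu
    have h7 := one_add_mul_ne_zero ht' hv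
    have key := ih _ (ccfMap_mem_ccfDisc (hω n) hu) _ (ccfMap_mem_ccfDisc (hω n) hv)
    simp only [ccfWord, Function.comp_apply]
    rw [key]
    simp only [contRatio, wordScale, ccfMap] at *
    generalize contRatio ω n = t at *
    generalize ω n = e at *
    have a1 : 1 + t * (1 / (e + v)) = (e + v + t) / (e + v) := by field_simp
    have a2 : 1 + t * (1 / (e + u)) = (e + u + t) / (e + u) := by field_simp
    have a3 : 1 + 1 / (e + t) * v = (e + v + t) / (e + t) := by field_simp; ring
    have a4 : 1 + 1 / (e + t) * u = (e + u + t) / (e + t) := by field_simp; ring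
    rw [a2] at h4
    rw [a1] at h5
    have b1 := (div_ne_zero_iff.1 h4).1
    have b2 := (div_ne_zero_iff.1 h5).1
    rw [a1, a2, a3, a4]
    field_simp
    ring

lemma norm_ccfWord_sub_le {ω : ℕ → ℂ} (hω : ∀ n, ω n ∈ gaussianE) (n : ℕ) {u v : ℂ}
    (hu : u ∈ ccfDisc) (hv : v ∈ ccfDisc) :
    ‖ccfWord ω n v - ccfWord ω n u‖ ≤ 2 * ‖wordScale ω n‖ * ‖v - u‖ := by
  have ht := contRatio_mem_ccfDisc hω n
  rw [ccfWord_sub hω n u hu v hv, norm_div, norm_mul, norm_mul]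
  have h1 := three_quarters_le_norm_one_add_mul ht hu
  have h2 := three_quarters_le_norm_one_add_mul ht hv
  have h3 : 1 / 2 ≤ ‖1 + contRatio ω n * v‖ * ‖1 + contRatio ω n * u‖ := by nlinarith
  rw [div_le_iff₀ (by linarith)]
  have h4 : 0 ≤ ‖wordScale ω n‖ * ‖v - u‖ := by positivity
  nlinarith

/-- The image of a disc under a word map contains a disc of comparable radius about the image of
the centre. -/
lemma ball_subset_ccfWord_image {ω : ℕ → ℂ} (hω : ∀ n, ω n ∈ gaussianE) (n : ℕ) {y : ℂ} {s : ℝ}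
    (hs : 0 < s) (hs1 : s ≤ 1) (hy : ball y s ⊆ ccfDisc) :
    ball (ccfWord ω n y) (‖wordScale ω n‖ * s / 8) ⊆ ccfWord ω n '' ball y s := by
  intro p hp
  have ht := contRatio_mem_ccfDisc hω n
  have hyX : y ∈ ccfDisc := hy (mem_ball_self hs)
  have hσ := wordScale_ne_zero hω n
  have hσ' : 0 < ‖wordScale ω n‖ := norm_pos_iff.2 hσ
  have key := ccfWord_sub hω n y hyX
  rw [mem_ball, Complex.dist_eq] at hp
  have h1 := norm_one_add_mul_le_two ht hyX
  have h1' := one_add_mul_ne_zero ht hyX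
  have ht1 := norm_le_one_of_mem_ccfDisc ht
  have hne : ∀ v ∈ ball y s, 1 + contRatio ω n * v ≠ 0 := fun v hv =>
    one_add_mul_ne_zero ht (hy hv)
  generalize wordScale ω n = σ at *
  generalize contRatio ω n = t at *
  -- The preimage of `p` is `v = (y + D) / (1 - D t)`, found by solving for `v` the difference
  -- formula `p - g y = σ (v - y) / ((1 + t v) (1 + t y))`, where `g` is the word map.
  obtain ⟨D, hD⟩ : ∃ D, D = (p - ccfWord ω n y) * (1 + t * y) / σ := ⟨_, rfl⟩
  have hDn : ‖D‖ < s / 4 := by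
    rw [hD, norm_div, norm_mul, div_lt_iff₀ hσ']
    nlinarith [norm_nonneg (p - ccfWord ω n y), norm_nonneg (1 + t * y)]
  have hDt : 1 / 2 ≤ ‖1 - D * t‖ := by
    have h2 : ‖D * t‖ ≤ 1 / 4 := by
      rw [norm_mul]
      nlinarith [norm_nonneg D, norm_nonneg t]
    have h3 := norm_sub_norm_le (1 : ℂ) (D * t)
    rw [norm_one] at h3
    linarith
  have hDt0 : 1 - D * t ≠ 0 := by rw [← norm_pos_iff]; linarith
  have hvy : (y + D) / (1 - D * t) - y = D * (1 + t * y) / (1 - D * t) := by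
    field_simp
    ring
  have hv : (y + D) / (1 - D * t) ∈ ball y s := by
    rw [mem_ball, Complex.dist_eq, hvy, norm_div, norm_mul, div_lt_iff₀ (by linarith)]
    nlinarith [norm_nonneg D, norm_nonneg (1 + t * y)]
  refine ⟨_, hv, ?_⟩
  have h5 := key _ (hy hv)
  have h6 := hne _ hv
  have h7 : 1 + t * ((y + D) / (1 - D * t)) = (1 + t * y) / (1 - D * t) := by
    rw [eq_div_iff hDt0, add_mul, one_mul, mul_assoc, div_mul_cancel₀ _ hDt0]
    ring
  rw [hvy, h7] at h5
  have h8 : σ * (D * (1 + t * y) / (1 - D * t)) /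
      ((1 + t * y) / (1 - D * t) * (1 + t * y)) = p - ccfWord ω n y := by
    have hD' : σ * D = (p - ccfWord ω n y) * (1 + t * y) := by
      rw [hD]
      field_simp
    calc _ = σ * D / (1 + t * y) := by field_simp
      _ = p - ccfWord ω n y := by rw [hD', mul_div_cancel_right₀ _ h1']
  rw [h8] at h5
  exact sub_left_injective h5

/-- A single step may be an isometry at a point, but two steps contract by a definite factor. -/
lemma norm_wordScale_add_two_le {ω : ℕ → ℂ} (hω : ∀ n, ω n ∈ gaussianE) (n : ℕ) :
    ‖wordScale ω (n + 2)‖ ≤ 16 / 25 * ‖wordScale ω n‖ := by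
  rw [norm_wordScale_succ, norm_wordScale_succ, div_div, ← mul_pow]
  have ht := contRatio_mem_ccfDisc hω n
  have h1 := one_le_re_add (hω n) ht
  have hn1 := one_le_norm_of_one_le_re h1
  have h2 := one_le_re_add (hω (n + 1)) (contRatio_mem_ccfDisc hω (n + 1))
  have hn2 := one_le_norm_of_one_le_re h2
  have h3 : (ω (n + 1) + contRatio ω (n + 1)).re
      = (ω (n + 1)).re + (ω n + contRatio ω n).re / ‖ω n + contRatio ω n‖ ^ 2 := by
    rw [contRatio, ccfMap, Complex.add_re, one_div, Complex.inv_re, Complex.normSq_eq_norm_sq]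
  have h4 := one_le_re_of_mem_gaussianE (hω (n + 1))
  have h5 : 5 / 4 ≤ ‖ω n + contRatio ω n‖ * ‖ω (n + 1) + contRatio ω (n + 1)‖ := by
    rcases le_total 2 ‖ω n + contRatio ω n‖ with h | h
    · nlinarith
    · have h6 : 1 / 4 ≤ (ω n + contRatio ω n).re / ‖ω n + contRatio ω n‖ ^ 2 := by
        rw [div_le_div_iff₀ (by norm_num) (by positivity)]
        nlinarith
      have h7 := Complex.re_le_norm (ω (n + 1) + contRatio ω (n + 1))
      nlinarith
  rw [div_le_iff₀ (by positivity)]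
  have h8 : 25 / 16 ≤ (‖ω n + contRatio ω n‖ * ‖ω (n + 1) + contRatio ω (n + 1)‖) ^ 2 := by
    nlinarith
  nlinarith [norm_nonneg (wordScale ω n)]

lemma exists_norm_wordScale_lt {ω : ℕ → ℂ} (hω : ∀ n, ω n ∈ gaussianE) {ε : ℝ} (hε : 0 < ε) :
    ∃ n, ‖wordScale ω n‖ < ε := by
  have h : ∀ k : ℕ, ‖wordScale ω (2 * k)‖ ≤ (16 / 25 : ℝ) ^ k := by
    intro k
    induction k with
    | zero => simp [wordScale]
    | succ k ih =>
      rw [pow_succ']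
      exact (norm_wordScale_add_two_le hω (2 * k)).trans (by gcongr)
  obtain ⟨k, hk⟩ := exists_pow_lt_of_lt_one hε (by norm_num : (16 / 25 : ℝ) < 1)
  exact ⟨2 * k, (h k).trans_lt hk⟩

/-! ### Gaps of the alphabet -/

/-- Below the scale `ρ` gaps are automatic, because distinct Gaussian integers are at distance at
least `1`. -/
lemma exists_gap_all_scales {I : Set ℂ} (hIE : I ⊆ gaussianE)
    (h : ∃ θ ∈ Ioo (0 : ℝ) 1, ∃ κ ∈ Ioo (0 : ℝ) 1, ∃ ρ > (0 : ℝ),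
      ∀ i ∈ I, ∀ R ∈ Icc ρ (κ * ‖i‖),
        ∃ y ∈ ball i R, gaussianE ∩ ball y (θ * R) ⊆ gaussianE \ I) :
    ∃ θ ∈ Ioo (0 : ℝ) 1, ∃ κ ∈ Ioo (0 : ℝ) 1, ∀ i ∈ I, ∀ R ∈ Ioc 0 (κ * ‖i‖),
      ∃ y ∈ ball i R, gaussianE ∩ ball y (θ * R) ⊆ gaussianE \ I := by
  obtain ⟨θ, ⟨hθ0, hθ1⟩, κ, hκ, ρ, hρ, h⟩ := h
  have hm0 : 0 < min θ (min (1 / 2) (1 / (2 * ρ))) := by positivity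
  have hmθ : min θ (min (1 / 2) (1 / (2 * ρ))) ≤ θ := min_le_left _ _
  have hm2 : min θ (min (1 / 2) (1 / (2 * ρ))) ≤ 1 / 2 :=
    (min_le_right _ _).trans (min_le_left _ _)
  have hmρ : min θ (min (1 / 2) (1 / (2 * ρ))) ≤ 1 / (2 * ρ) :=
    (min_le_right _ _).trans (min_le_right _ _)
  generalize min θ (min (1 / 2) (1 / (2 * ρ))) = m at *
  refine ⟨m, ⟨hm0, by linarith⟩, κ, hκ, fun i hi R hR => ?_⟩
  rcases le_total ρ R with hρR | hRρ
  · obtain ⟨y, hy, hsub⟩ := h i hi R ⟨hρR, hR.2⟩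
    refine ⟨y, hy, Subset.trans (inter_subset_inter_right _ (ball_subset_ball ?_)) hsub⟩
    exact mul_le_mul_of_nonneg_right hmθ hR.1.le
  · have hr0 : 0 < min R 1 := lt_min hR.1 one_pos
    have hrR : min R 1 ≤ R := min_le_left _ _
    have hr1 : min R 1 ≤ 1 := min_le_right _ _
    have hmR : m * R ≤ min R 1 / 2 := by
      rcases le_total R 1 with h1 | h1
      · rw [min_eq_left h1]
        nlinarith [hR.1]
      · rw [min_eq_right h1]
        have := (le_div_iff₀ (by positivity)).1 hmρ
        nlinarith
    generalize min R 1 = r at *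
    have hd : ‖((r / 2 : ℝ) : ℂ)‖ = r / 2 := by
      rw [Complex.norm_real, Real.norm_of_nonneg (by linarith)]
    refine ⟨i + (r / 2 : ℝ), ?_, fun e he => ⟨he.1, fun heI => ?_⟩⟩
    · rw [mem_ball, Complex.dist_eq, add_sub_cancel_left, hd]
      linarith
    · have h1 := he.2
      rw [mem_ball, Complex.dist_eq] at h1
      by_cases hei : e = i
      · rw [hei, sub_add_cancel_left, norm_neg, hd] at h1
        linarith
      · have h2 := one_le_dist_of_mem_gaussianE he.1 (hIE hi) hei
        have h3 : e - i = (e - (i + (r / 2 : ℝ))) + (r / 2 : ℝ) := by ring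
        have h4 := norm_add_le (e - (i + (r / 2 : ℝ))) ((r / 2 : ℝ) : ℂ)
        rw [← h3, hd] at h4
        linarith

/-- Gaps near the letters give gaps at all scales about all points of the closed right half plane,
and gaps lying inside the open right half plane. A gap near a letter could a priori be void because
it leaves the half plane; moving the centre by `R / 2` to the right prevents this, and a smaller
disc about the new centre either is itself a gap or contains a letter. -/
lemma exists_gap_in_halfPlane {I : Set ℂ} (hIE : I ⊆ gaussianE)
    (h : ∃ θ ∈ Ioo (0 : ℝ) 1, ∃ κ ∈ Ioo (0 : ℝ) 1, ∀ i ∈ I, ∀ R ∈ Ioc 0 (κ * ‖i‖),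
      ∃ y ∈ ball i R, gaussianE ∩ ball y (θ * R) ⊆ gaussianE \ I) :
    ∃ θ ∈ Ioo (0 : ℝ) 1, ∀ w : ℂ, 0 ≤ w.re → ∀ R > (0 : ℝ),
      ∃ y, ball y (θ * R) ⊆ ball w R ∩ {v | 0 < v.re} ∧ ∀ e ∈ I, e ∉ ball y (θ * R) := by
  obtain ⟨θ, ⟨hθ0, hθ1⟩, κ, ⟨hκ0, hκ1⟩, h⟩ := h
  have hθκ : θ * κ < 1 := by nlinarith
  refine ⟨θ * κ / 8, ⟨by positivity, by linarith⟩, fun w hw R hR => ?_⟩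
  obtain ⟨w', rfl⟩ : ∃ w', w = w' - (R / 2 : ℝ) := ⟨w + (R / 2 : ℝ), by ring⟩
  have hw' : R / 2 ≤ w'.re := by
    rw [Complex.sub_re, Complex.ofReal_re] at hw
    linarith
  have hsub : ball w' (3 * (κ * R / 8)) ⊆ ball (w' - (R / 2 : ℝ)) R ∩ {v | 0 < v.re} := by
    intro v hv
    rw [mem_ball, Complex.dist_eq] at hv
    have hlt : ‖v - w'‖ < R / 2 := by nlinarith
    refine ⟨?_, ?_⟩
    · rw [mem_ball, Complex.dist_eq]
      have h4 := norm_add_le (v - w') ((R / 2 : ℝ) : ℂ)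
      rw [Complex.norm_real, Real.norm_of_nonneg (by linarith : (0 : ℝ) ≤ R / 2)] at h4
      have h3 : v - (w' - (R / 2 : ℝ)) = (v - w') + (R / 2 : ℝ) := by ring
      rw [h3]
      linarith
    · have h5 := (abs_le.1 (Complex.abs_re_le_norm (v - w'))).1
      rw [Complex.sub_re] at h5
      change 0 < v.re
      linarith
  have hs0 : 0 < κ * R / 8 := by positivity
  have hθs : θ * κ / 8 * R = θ * (κ * R / 8) := by ring
  have hsR : κ * R / 8 ≤ R / 8 := by nlinarith
  rw [hθs]
  by_cases hI : ∃ i ∈ I, i ∈ ball w' (κ * R / 8)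
  · obtain ⟨i, hi, hiw⟩ := hI
    rw [mem_ball, Complex.dist_eq] at hiw
    have hin : κ * R / 8 ≤ κ * ‖i‖ := by
      have h5 := (abs_le.1 (Complex.abs_re_le_norm (i - w'))).1
      rw [Complex.sub_re] at h5
      have h6 : R / 8 ≤ ‖i‖ := by linarith [Complex.re_le_norm i]
      nlinarith
    obtain ⟨y, hy, hgap⟩ := h i hi _ ⟨hs0, hin⟩
    refine ⟨y, Subset.trans (fun v hv => ?_) hsub, fun e he hey => (hgap ⟨hIE he, hey⟩).2 he⟩
    rw [mem_ball, Complex.dist_eq] at hv hy ⊢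
    have h7 : v - w' = (v - y) + (y - i) + (i - w') := by ring
    rw [h7]
    have h8 := norm_add₃_le (a := v - y) (b := y - i) (c := i - w')
    nlinarith
  · push Not at hI
    have hle : θ * (κ * R / 8) ≤ κ * R / 8 := by nlinarith
    exact ⟨w', (ball_subset_ball (by linarith)).trans hsub,
      fun e he hew => hI e he (ball_subset_ball hle hew)⟩

/-! ### Inversion -/

lemma norm_inv_sub_inv {v w : ℂ} (hv : v ≠ 0) (hw : w ≠ 0) :
    ‖1 / v - 1 / w‖ = ‖v - w‖ / (‖v‖ * ‖w‖) := by
  have h : 1 / v - 1 / w = -(v - w) / (v * w) := by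
    field_simp
    ring
  rw [h, norm_div, norm_neg, norm_mul]

/-- A gap of the alphabet at a scale `R` above the diameter of `X` becomes, under inversion, a hole
of `J_I` inside the open disc. -/
lemma exists_hole_near_inv {I : Set ℂ} {θ : ℝ} (hθ : θ ∈ Ioo (0 : ℝ) 1)
    (h : ∀ w : ℂ, 0 ≤ w.re → ∀ R > (0 : ℝ),
      ∃ y, ball y (θ * R) ⊆ ball w R ∩ {v | 0 < v.re} ∧ ∀ e ∈ I, e ∉ ball y (θ * R))
    {w : ℂ} (hw : 0 ≤ w.re) {R : ℝ} (hR : 4 ≤ θ * R) (hRw : R ≤ ‖w‖ / 4) :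
    ∃ y, ball y (θ * R / (16 * ‖w‖ ^ 2)) ⊆
      (ball (1 / w) (2 * R / ‖w‖ ^ 2) ∩ ball (1 / 2 : ℂ) (1 / 2)) \ ccfLimitSet I := by
  obtain ⟨hθ0, hθ1⟩ := hθ
  have hR0 : 0 < R := by
    by_contra! h0
    nlinarith
  have hθR : θ * R < R := by nlinarith
  obtain ⟨y, hy, hgap⟩ := h w hw R hR0
  have hw0 : 0 < ‖w‖ := by linarith
  have hyw := (hy (mem_ball_self (by linarith))).1
  rw [mem_ball, Complex.dist_eq] at hyw
  have hy1 : ‖y‖ ≤ 2 * ‖w‖ := by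
    have := norm_sub_norm_le y w
    linarith
  have hy2 : ‖w‖ / 2 ≤ ‖y‖ := by
    have := norm_sub_norm_le w y
    rw [norm_sub_rev] at this
    linarith
  have hy0 : y ≠ 0 := by
    rw [← norm_pos_iff]
    linarith
  have hyre : θ * R ≤ y.re := by
    -- Otherwise the disc about `y` contains the projection of `y` to the imaginary axis.
    by_contra! hlt
    have hypos : 0 < y.re := (hy (mem_ball_self (by linarith))).2
    have hmem : y - (y.re : ℝ) ∈ ball y (θ * R) := by
      rw [mem_ball, Complex.dist_eq, sub_sub_cancel_left, norm_neg, Complex.norm_real,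
        Real.norm_of_nonneg hypos.le]
      exact hlt
    have := (hy hmem).2
    simp at this
  refine ⟨1 / y, fun p hp => ?_⟩
  rw [mem_ball, Complex.dist_eq] at hp
  have hη : θ * R / (16 * ‖w‖ ^ 2) ≤ 1 / (4 * ‖w‖) := by
    rw [div_le_div_iff₀ (by positivity) (by positivity)]
    nlinarith
  have hyinv : 1 / (2 * ‖w‖) ≤ ‖1 / y‖ := by
    rw [norm_div, norm_one]
    exact one_div_le_one_div_of_le (norm_pos_iff.2 hy0) hy1
  have hhalf : 1 / (2 * ‖w‖) = 1 / (4 * ‖w‖) + 1 / (4 * ‖w‖) := by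
    field_simp
    norm_num
  have hpn : 1 / (4 * ‖w‖) ≤ ‖p‖ := by
    have := norm_sub_norm_le (1 / y) p
    rw [norm_sub_rev] at this
    linarith
  have hp0 : p ≠ 0 := by
    rw [← norm_pos_iff]
    exact lt_of_lt_of_le (by positivity) hpn
  obtain ⟨v, rfl⟩ : ∃ v, p = 1 / v := ⟨1 / p, by rw [one_div_one_div]⟩
  have hv0 : v ≠ 0 := by
    rintro rfl
    simp at hp0
  have hvn : ‖v‖ ≤ 4 * ‖w‖ := by
    rw [norm_div, norm_one] at hpn
    exact (one_div_le_one_div (by positivity) (norm_pos_iff.2 hv0)).1 hpn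
  have hvy : ‖v - y‖ < θ * R / 2 := by
    have hv1 : 0 < ‖v‖ := norm_pos_iff.2 hv0
    have hy3 : 0 < ‖y‖ := norm_pos_iff.2 hy0
    rw [norm_inv_sub_inv hv0 hy0, div_lt_div_iff₀ (by positivity) (by positivity)] at hp
    have h1 : ‖v‖ * ‖y‖ ≤ 8 * ‖w‖ ^ 2 := by nlinarith
    have h2 : θ * R * (‖v‖ * ‖y‖) ≤ θ * R * (8 * ‖w‖ ^ 2) :=
      mul_le_mul_of_nonneg_left h1 (by linarith)
    have h3 : 0 < 16 * ‖w‖ ^ 2 := by positivity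
    nlinarith
  have hvball : v ∈ ball y (θ * R) := by
    rw [mem_ball, Complex.dist_eq]
    linarith
  have hvw := (hy hvball).1
  rw [mem_ball, Complex.dist_eq] at hvw
  refine ⟨⟨?_, inv_mem_openDisc ?_⟩, fun hJ => ?_⟩
  · have hw0' : w ≠ 0 := norm_pos_iff.1 hw0
    have hv2 : ‖w‖ / 2 ≤ ‖v‖ := by
      have := norm_sub_norm_le w v
      rw [norm_sub_rev] at this
      linarith
    rw [mem_ball, Complex.dist_eq, norm_inv_sub_inv hv0 hw0',
      div_lt_div_iff₀ (by positivity) (by positivity)]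
    have h1 : R * ‖w‖ ^ 2 ≤ 2 * R * (‖v‖ * ‖w‖) := by
      have : ‖w‖ * ‖w‖ ≤ 2 * (‖v‖ * ‖w‖) := by nlinarith
      nlinarith
    have h3 : 0 < ‖w‖ ^ 2 := by positivity
    nlinarith
  · have h5 := (abs_le.1 (Complex.abs_re_le_norm (v - y))).1
    rw [Complex.sub_re] at h5
    linarith
  · obtain ⟨e, he, q, hq, heq⟩ := exists_eq_ccfMap_of_mem_ccfLimitSet hJ
    have h1 : v = e + q := by
      apply inv_injective
      rw [inv_eq_one_div, inv_eq_one_div]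
      exact heq
    refine hgap e he ?_
    rw [mem_ball, Complex.dist_eq]
    have h2 : e - y = (v - y) - q := by rw [h1]; ring
    rw [h2]
    have h3 := norm_le_one_of_mem_ccfDisc (ccfLimitSet_subset_ccfDisc I hq)
    linarith [norm_sub_le (v - y) q]

/-! ### From gaps to porosity -/

/-- A word map carries holes of `J_I` in the open disc to holes of `J_I` of comparable size, by
bounded distortion and the open set condition. -/
lemma exists_hole_ccfWord {I : Set ℂ} (hIE : I ⊆ gaussianE) {ω : ℕ → ℂ} (hω : ∀ n, ω n ∈ I)
    (n : ℕ) {z : ℂ} (hz : z ∈ ccfDisc) {y : ℂ} {s r : ℝ} (hs : 0 < s) (hs1 : s ≤ 1)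
    (hy : ball y s ⊆ (ball z r ∩ ball (1 / 2 : ℂ) (1 / 2)) \ ccfLimitSet I) :
    ball (ccfWord ω n y) (‖wordScale ω n‖ * s / 8) ⊆
      ball (ccfWord ω n z) (2 * ‖wordScale ω n‖ * r) \ ccfLimitSet I := by
  have hω' : ∀ n, ω n ∈ gaussianE := fun n => hIE (hω n)
  intro p hp
  obtain ⟨v, hv, rfl⟩ := ball_subset_ccfWord_image hω' n hs hs1
    (fun u hu => openDisc_subset_ccfDisc (hy hu).1.2) hp
  refine ⟨?_, fun hJ => (hy hv).2 (mem_ccfLimitSet_of_ccfWord_mem hIE n ω hω v (hy hv).1.2 hJ)⟩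
  have h1 := norm_ccfWord_sub_le hω' n hz (openDisc_subset_ccfDisc (hy hv).1.2)
  have h2 := (hy hv).1.1
  rw [mem_ball, Complex.dist_eq] at h2 ⊢
  have h3 : 0 < ‖wordScale ω n‖ := norm_pos_iff.2 (wordScale_ne_zero hω' n)
  exact h1.trans_lt (by gcongr)

/-- Holes of `J_I` near the point `1 / w` at the scale `r`, as long as `r` is small and the pulled
back scale `r * ‖w‖ ^ 2` is large. If `r * ‖w‖ ≤ 2`, the disc about `1 / w` contains the image
under inversion of a disc about `w` of radius comparable with `r * ‖w‖ ^ 2`. Otherwise it contains points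
close to `0` at the scale `r`, and these are images of points close to `4 / r`. -/
lemma exists_hole_at_scale {I : Set ℂ} {θ : ℝ} (hθ : θ ∈ Ioo (0 : ℝ) 1)
    (h : ∀ w : ℂ, 0 ≤ w.re → ∀ R > (0 : ℝ),
      ∃ y, ball y (θ * R) ⊆ ball w R ∩ {v | 0 < v.re} ∧ ∀ e ∈ I, e ∉ ball y (θ * R))
    {w : ℂ} (hw : 1 ≤ w.re) {r : ℝ} (hr0 : 0 < r) (hr : 4 * r ≤ θ) (hrw : 32 ≤ θ * (r * ‖w‖ ^ 2)) :
    ∃ y, ball y (θ * r / 256) ⊆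
      (ball (1 / w) r ∩ ball (1 / 2 : ℂ) (1 / 2)) \ ccfLimitSet I := by
  have hw1 := one_le_norm_of_one_le_re hw
  obtain ⟨hθ0, -⟩ := id hθ
  rcases le_or_gt (r * ‖w‖) 2 with hcase | hcase
  · obtain ⟨y, hy⟩ := exists_hole_near_inv hθ h (w := w) (by linarith)
      (R := r * ‖w‖ ^ 2 / 8) (by linarith) (by nlinarith)
    have h1 : 2 * (r * ‖w‖ ^ 2 / 8) / ‖w‖ ^ 2 = r / 4 := by
      field_simp
      norm_num
    have h2 : θ * (r * ‖w‖ ^ 2 / 8) / (16 * ‖w‖ ^ 2) = θ * r / 128 := by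
      field_simp
      norm_num
    rw [h1, h2] at hy
    refine ⟨y, fun p hp => ?_⟩
    have h3 := hy (ball_subset_ball (by nlinarith) hp)
    exact ⟨⟨ball_subset_ball (by linarith) h3.1.1, h3.1.2⟩, h3.2⟩
  · have hn : ‖((4 / r : ℝ) : ℂ)‖ = 4 / r := by
      rw [Complex.norm_real, Real.norm_of_nonneg (by positivity)]
    obtain ⟨y, hy⟩ := exists_hole_near_inv hθ h (w := ((4 / r : ℝ) : ℂ))
      (by rw [Complex.ofReal_re]; positivity)
      (R := 1 / r) (by rw [mul_one_div, le_div_iff₀ hr0]; exact hr) (by rw [hn]; ring_nf; rfl)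
    rw [hn] at hy
    have h1 : 2 * (1 / r) / (4 / r) ^ 2 = r / 8 := by
      field_simp
      norm_num
    have h2 : θ * (1 / r) / (16 * (4 / r) ^ 2) = θ * r / 256 := by
      field_simp
      norm_num
    rw [h1, h2] at hy
    refine ⟨y, fun p hp => ?_⟩
    have h3 := hy hp
    refine ⟨⟨?_, h3.1.2⟩, h3.2⟩
    have h4 := h3.1.1
    rw [mem_ball, Complex.dist_eq] at h4 ⊢
    have h5 : p - 1 / w = (p - 1 / ((4 / r : ℝ) : ℂ)) + 1 / ((4 / r : ℝ) : ℂ) - 1 / w := by ring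
    have h6 : ‖1 / ((4 / r : ℝ) : ℂ)‖ = r / 4 := by
      rw [norm_div, norm_one, hn, one_div_div]
    have h7 : ‖1 / w‖ < r / 2 := by
      rw [norm_div, norm_one, div_lt_iff₀ (by linarith)]
      linarith
    rw [h5]
    have h8 := norm_sub_le ((p - 1 / ((4 / r : ℝ) : ℂ)) + 1 / ((4 / r : ℝ) : ℂ)) (1 / w)
    have h9 := norm_add_le (p - 1 / ((4 / r : ℝ) : ℂ)) (1 / ((4 / r : ℝ) : ℂ))
    linarith

/-- The stopping index `n` satisfies `‖wordScale ω (n + 1)‖ ≤ r / 2 < ‖wordScale ω n‖`. If the two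
scales are comparable, a fixed hole of `X` is transported to the level `n + 1`. Otherwise the letter
`ω n` is large, and its gap produces a hole that is transported to the level `n`. -/
lemma isPorous_of_gaps {I : Set ℂ} (hIE : I ⊆ gaussianE)
    (h : ∃ θ ∈ Ioo (0 : ℝ) 1, ∃ κ ∈ Ioo (0 : ℝ) 1, ∀ i ∈ I, ∀ R ∈ Ioc 0 (κ * ‖i‖),
      ∃ y ∈ ball i R, gaussianE ∩ ball y (θ * R) ⊆ gaussianE \ I) :
    IsPorous (closure (ccfLimitSet I)) := by
  obtain ⟨θ, hθ, h⟩ := exists_gap_in_halfPlane hIE h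
  obtain ⟨hθ0, hθ1⟩ := id hθ
  obtain ⟨y₀, s₀, hs₀, hs₀1, hy₀⟩ : ∃ y₀ s₀, 0 < s₀ ∧ s₀ ≤ 1 ∧
      ball y₀ s₀ ⊆ ball (1 / 2 : ℂ) (1 / 2) \ ccfLimitSet I := by
    have hn : ‖((16 / θ : ℝ) : ℂ)‖ = 16 / θ := by
      rw [Complex.norm_real, Real.norm_of_nonneg (by positivity)]
    obtain ⟨y, hy⟩ := exists_hole_near_inv hθ h (w := ((16 / θ : ℝ) : ℂ))
      (by rw [Complex.ofReal_re]; positivity)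
      (R := 4 / θ) (by rw [mul_div_cancel₀ _ hθ0.ne']) (by rw [hn]; ring_nf; rfl)
    rw [hn] at hy
    refine ⟨y, min 1 (θ * (4 / θ) / (16 * (16 / θ) ^ 2)), lt_min one_pos (by positivity),
      min_le_left _ _, fun p hp => ?_⟩
    have h1 := hy (ball_subset_ball (min_le_right _ _) hp)
    exact ⟨h1.1.2, h1.2⟩
  have hc : 0 < min (θ ^ 2 / 4096 * s₀ / 8) (θ ^ 2 / 32768) := by positivity
  refine isPorous_closure_of_exists_hole hc one_pos fun x hx r hr => ?_
  obtain ⟨hr0, hr1⟩ := hr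
  obtain ⟨ω, hω, hxω⟩ := mem_ccfLimitSet.1 hx
  have hω' : ∀ n, ω n ∈ gaussianE := fun n => hIE (hω n)
  have hex : ∃ n, ‖wordScale ω n‖ ≤ r / 2 :=
    (exists_norm_wordScale_lt hω' (half_pos hr0)).imp fun n hn => hn.le
  obtain ⟨n, hn1, hn⟩ : ∃ n, ‖wordScale ω (n + 1)‖ ≤ r / 2 ∧ r / 2 < ‖wordScale ω n‖ := by
    classical
    have hpos : Nat.find hex ≠ 0 := by
      intro h0
      have := Nat.find_spec hex
      rw [h0] at this
      simp only [wordScale, norm_one] at this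
      linarith
    obtain ⟨n, hn⟩ := Nat.exists_eq_succ_of_ne_zero hpos
    refine ⟨n, ?_, ?_⟩
    · have := Nat.find_spec hex
      rwa [hn] at this
    · exact not_le.1 (Nat.find_min hex (by omega))
  have hlam : 0 < ‖wordScale ω n‖ := norm_pos_iff.2 (wordScale_ne_zero hω' n)
  rcases le_total (θ ^ 2 / 4096 * r) ‖wordScale ω (n + 1)‖ with hcase | hcase
  · obtain ⟨z, hz, rfl⟩ := hxω.exists_eq_ccfWord (n + 1)
    have hzX := hz.mem_ccfDisc
    have hole : ball y₀ s₀ ⊆ (ball z 1 ∩ ball (1 / 2 : ℂ) (1 / 2)) \ ccfLimitSet I := by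
      intro p hp
      refine ⟨⟨?_, (hy₀ hp).1⟩, (hy₀ hp).2⟩
      have h1 := (hy₀ hp).1
      have h2 : dist z (1 / 2) ≤ 1 / 2 := hzX
      rw [mem_ball] at h1 ⊢
      linarith [dist_triangle_right p z (1 / 2)]
    have h1 := exists_hole_ccfWord hIE hω (n + 1) hzX hs₀ hs₀1 hole
    refine ⟨_, Subset.trans (ball_subset_ball ?_) (h1.trans
      (sdiff_subset_sdiff_left (ball_subset_ball (by linarith))))⟩
    have h2 := min_le_left (θ ^ 2 / 4096 * s₀ / 8) (θ ^ 2 / 32768)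
    calc _ ≤ θ ^ 2 / 4096 * s₀ / 8 * r := mul_le_mul_of_nonneg_right h2 hr0.le
      _ = θ ^ 2 / 4096 * r * s₀ / 8 := by ring
      _ ≤ _ := by gcongr
  · obtain ⟨z, hz, rfl⟩ := hxω.exists_eq_ccfWord n
    obtain ⟨z', hz', hzz'⟩ := hz.exists_eq_ccfMap
    rw [zero_add] at hzz'
    have hw := one_le_re_add (hω' n) hz'.mem_ccfDisc
    have hw1 := one_le_norm_of_one_le_re hw
    -- `r / (2 * ‖wordScale ω n‖)` is the radius `r` pulled back to the level `n`; the factor `θ / 4`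
    -- makes it small enough for `exists_hole_at_scale`.
    have hr'0 : 0 < θ / 4 * (r / (2 * ‖wordScale ω n‖)) := by positivity
    have hq : r / (2 * ‖wordScale ω n‖) ≤ 1 := by
      rw [div_le_one (by positivity)]
      linarith
    have hbig : 32 ≤ θ * (θ / 4 * (r / (2 * ‖wordScale ω n‖)) * ‖ω n + z'‖ ^ 2) := by
      rw [norm_wordScale_succ] at hcase
      have ht := contRatio_mem_ccfDisc hω' n
      have ht1 := one_le_norm_of_one_le_re (one_le_re_add (hω' n) ht)
      rw [div_le_iff₀ (by positivity)] at hcase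
      have h1 : ‖ω n + contRatio ω n‖ ≤ 3 * ‖ω n + z'‖ := by
        have h2 : ω n + contRatio ω n = (ω n + z') + contRatio ω n - z' := by ring
        rw [h2]
        have h3 := norm_sub_le ((ω n + z') + contRatio ω n) z'
        have h4 := norm_add_le (ω n + z') (contRatio ω n)
        linarith [norm_le_one_of_mem_ccfDisc ht, norm_le_one_of_mem_ccfDisc hz'.mem_ccfDisc]
      have h5 : ‖wordScale ω n‖ ≤ θ ^ 2 / 4096 * r * (3 * ‖ω n + z'‖) ^ 2 :=
        hcase.trans (by gcongr)
      have h6 : θ * (θ / 4 * (r / (2 * ‖wordScale ω n‖)) * ‖ω n + z'‖ ^ 2)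
          = θ ^ 2 * r * ‖ω n + z'‖ ^ 2 / (8 * ‖wordScale ω n‖) := by
        field_simp
        norm_num
      rw [h6, le_div_iff₀ (by positivity)]
      nlinarith
    obtain ⟨y, hy⟩ := exists_hole_at_scale hθ h hw hr'0 (by nlinarith) hbig
    have hz1 : 1 / (ω n + z') = z := hzz'.symm
    rw [hz1] at hy
    have h1 := exists_hole_ccfWord hIE hω n hz.mem_ccfDisc (by positivity) (by nlinarith) hy
    have h3 : 2 * ‖wordScale ω n‖ * (θ / 4 * (r / (2 * ‖wordScale ω n‖))) = θ / 4 * r := by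
      field_simp
    have h4 : ‖wordScale ω n‖ * (θ * (θ / 4 * (r / (2 * ‖wordScale ω n‖))) / 256) / 8
        = θ ^ 2 / 16384 * r := by
      field_simp
      norm_num
    rw [h3, h4] at h1
    refine ⟨_, Subset.trans (ball_subset_ball ?_) (h1.trans
      (sdiff_subset_sdiff_left (ball_subset_ball (by nlinarith))))⟩
    have h2 := min_le_right (θ ^ 2 / 4096 * s₀ / 8) (θ ^ 2 / 32768)
    have h5 : 0 < θ ^ 2 := by positivity
    nlinarith

/-! ### From porosity to gaps -/

/-- Near a point `1 / (i + z₀)` of `J_I` inversion is, up to the factor `‖i + z₀‖ ^ 2`,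
bi-Lipschitz, and it carries a hole of `J_I` to a disc free of the points `e + z₀` with `e ∈ I`. -/
lemma exists_gap_of_isPorous {I : Set ℂ} (hIE : I ⊆ gaussianE) (hI : I.Nonempty)
    (h : IsPorous (closure (ccfLimitSet I))) :
    ∃ θ ∈ Ioo (0 : ℝ) 1, ∃ κ ∈ Ioo (0 : ℝ) 1, ∃ ρ > (0 : ℝ),
      ∀ i ∈ I, ∀ R ∈ Icc ρ (κ * ‖i‖),
        ∃ y ∈ ball i R, gaussianE ∩ ball y (θ * R) ⊆ gaussianE \ I := by
  obtain ⟨c, ⟨hc0, hc1⟩, r₀, hr₀, h⟩ := exists_hole_of_isPorous h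
  obtain ⟨z₀, hz₀⟩ := ccfLimitSet_nonempty hIE hI
  have hz₀X := ccfLimitSet_subset_ccfDisc I hz₀
  have hz₀1 := norm_le_one_of_mem_ccfDisc hz₀X
  refine ⟨c / 128, ⟨by linarith, by linarith⟩, 1 / 4, ⟨by norm_num, by norm_num⟩,
    128 / c + 1 / r₀, by positivity, fun i hi R hR => ?_⟩
  have hR1 : 128 / c ≤ R := by linarith [hR.1, one_div_pos.2 hr₀]
  have hR2 : 1 / r₀ ≤ R := by linarith [hR.1, div_pos (by norm_num : (0 : ℝ) < 128) hc0]
  rw [div_le_iff₀ hc0] at hR1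
  rw [div_le_iff₀ hr₀] at hR2
  have hR128 : 128 ≤ R := by nlinarith
  have hR0 : 0 < R := by linarith
  obtain ⟨w, hw⟩ : ∃ w, w = i + z₀ := ⟨_, rfl⟩
  have hwre : 1 ≤ w.re := hw ▸ one_le_re_add (hIE hi) hz₀X
  have hw0 : w ≠ 0 := ne_zero_of_one_le_re hwre
  have hRw : R ≤ ‖w‖ / 2 := by
    have h1 : i = w - z₀ := by rw [hw]; ring
    have h2 := norm_sub_le w z₀
    rw [← h1] at h2
    linarith [hR.2, one_le_norm_of_one_le_re hwre]
  have hwpos : 0 < ‖w‖ := by linarith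
  have hxJ : 1 / w ∈ ccfLimitSet I := hw ▸ ccfMap_mem_ccfLimitSet hIE hi hz₀
  have hr16 : R / (8 * ‖w‖ ^ 2) ≤ 1 / (16 * ‖w‖) := by
    rw [div_le_div_iff₀ (by positivity) (by positivity)]
    nlinarith
  have hrr₀ : R / (8 * ‖w‖ ^ 2) < r₀ := by
    rw [div_lt_iff₀ (by positivity)]
    nlinarith
  obtain ⟨y, hy⟩ := h _ (subset_closure hxJ) _ ⟨by positivity, hrr₀⟩
  have hyx := (hy (mem_ball_self (by positivity))).1
  rw [mem_ball, Complex.dist_eq] at hyx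
  have hyn : 1 / (2 * ‖w‖) ≤ ‖y‖ := by
    have h1 := norm_sub_norm_le (1 / w) y
    rw [norm_sub_rev, norm_div, norm_one] at h1
    have h2 : 1 / ‖w‖ = 1 / (2 * ‖w‖) + 8 * (1 / (16 * ‖w‖)) := by
      field_simp
      norm_num
    have h3 : 0 < 1 / (16 * ‖w‖) := by positivity
    linarith
  have hy0 : y ≠ 0 := by
    rw [← norm_pos_iff]
    exact lt_of_lt_of_le (by positivity) hyn
  obtain ⟨v, rfl⟩ : ∃ v, y = 1 / v := ⟨1 / y, by rw [one_div_one_div]⟩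
  have hv0 : v ≠ 0 := by
    rintro rfl
    simp at hy0
  have hvpos : 0 < ‖v‖ := norm_pos_iff.2 hv0
  have hvn : ‖v‖ ≤ 2 * ‖w‖ := by
    rw [norm_div, norm_one] at hyn
    exact (one_div_le_one_div (by positivity) hvpos).1 hyn
  have hvw : ‖v - w‖ < R / 4 := by
    rw [norm_inv_sub_inv hv0 hw0, div_lt_div_iff₀ (by positivity) (by positivity)] at hyx
    have h1 : R * (‖v‖ * ‖w‖) ≤ R * (2 * ‖w‖ * ‖w‖) := by gcongr
    have h2 : 0 < ‖w‖ ^ 2 := by positivity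
    nlinarith
  refine ⟨v, ?_, fun e he => ⟨he.1, fun heI => ?_⟩⟩
  · rw [mem_ball, Complex.dist_eq]
    have h1 : v - i = (v - w) + z₀ := by rw [hw]; ring
    rw [h1]
    linarith [norm_add_le (v - w) z₀]
  · have hev := he.2
    rw [mem_ball, Complex.dist_eq] at hev
    have hu0 := ne_zero_of_one_le_re (one_le_re_add he.1 hz₀X)
    have huJ : 1 / (e + z₀) ∈ ccfLimitSet I := ccfMap_mem_ccfLimitSet hIE heI hz₀
    -- The offset `z₀` is absorbed, since `‖z₀‖ ≤ 1 ≤ c / 128 * R`.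
    have huv : ‖e + z₀ - v‖ < 2 * (c / 128 * R) := by
      have h1 : e + z₀ - v = (e - v) + z₀ := by ring
      rw [h1]
      linarith [norm_add_le (e - v) z₀]
    have hv2 : 7 / 8 * ‖w‖ ≤ ‖v‖ := by
      have h1 := norm_sub_norm_le w v
      rw [norm_sub_rev] at h1
      linarith
    have hu2 : ‖w‖ / 2 ≤ ‖e + z₀‖ := by
      have h1 := norm_sub_norm_le v (e + z₀)
      rw [norm_sub_rev] at h1
      nlinarith
    have hupos : 0 < ‖e + z₀‖ := norm_pos_iff.2 hu0
    suffices hmem : 1 / (e + z₀) ∈ ball (1 / v) (c * (R / (8 * ‖w‖ ^ 2))) from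
      (hy hmem).2 (subset_closure huJ)
    rw [mem_ball, Complex.dist_eq, norm_inv_sub_inv hu0 hv0, mul_div_assoc',
      div_lt_div_iff₀ (by positivity) (by positivity)]
    have h1 : ‖w‖ / 2 * (7 / 8 * ‖w‖) ≤ ‖e + z₀‖ * ‖v‖ := by gcongr
    have h2 : c * R * (‖w‖ / 2 * (7 / 8 * ‖w‖)) ≤ c * R * (‖e + z₀‖ * ‖v‖) := by gcongr
    have h3 : ‖e + z₀ - v‖ * (8 * ‖w‖ ^ 2) < 2 * (c / 128 * R) * (8 * ‖w‖ ^ 2) := by gcongr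
    have h4 : 0 < c * R * ‖w‖ ^ 2 := by positivity
    nlinarith

theorem mainTheorem8 (I : Set ℂ) (hIE : I ⊆ gaussianE) (hI : I.Infinite) :
    (IsPorous (closure (ccfLimitSet I)) ↔
      ∃ θ ∈ Set.Ioo (0 : ℝ) 1, ∃ κ ∈ Set.Ioo (0 : ℝ) 1, ∃ ρ > (0 : ℝ),
        ∀ i ∈ I, ∀ R ∈ Set.Icc ρ (κ * ‖i‖),
          ∃ y ∈ Metric.ball i R, gaussianE ∩ Metric.ball y (θ * R) ⊆ gaussianE \ I) ∧
    (IsPorous (closure (ccfLimitSet I)) ↔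
      ∃ θ ∈ Set.Ioo (0 : ℝ) 1, ∃ κ ∈ Set.Ioo (0 : ℝ) 1,
        ∀ i ∈ I, ∀ R ∈ Set.Ioc 0 (κ * ‖i‖),
          ∃ y ∈ Metric.ball i R, gaussianE ∩ Metric.ball y (θ * R) ⊆ gaussianE \ I) :=
  ⟨⟨exists_gap_of_isPorous hIE hI.nonempty,
      fun h => isPorous_of_gaps hIE (exists_gap_all_scales hIE h)⟩,
    ⟨fun h => exists_gap_all_scales hIE (exists_gap_of_isPorous hIE hI.nonempty h),
      isPorous_of_gaps hIE⟩⟩
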